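/- All logarithms are to base 2, and all alphabets (those of auxiliary random variables too) are finite. $H_b$ is the binary entropy function and $H_b^{-1}:[0,1]\to[0,\frac12]$ its inverse. For a pair of sources $(S_1,S_2)$ with distribution $p_{(S_1,S_2)}$, the common part $S_0$ is the connected component containing $S_1$ in the bipartite graph on the disjoint union of the alphabets of $S_1$ and $S_2$ in which $s_1$ and $s_2$ are adjacent when $p_{(S_1,S_2)}(s_1,s_2)>0$. Let $p_{Y_1,Y_2|X}$ be a broadcast channel and $\kappa$ a bandwidth expansion constraint. The *Gohari-Anantharam condition* holds if there are distributions $p_X$ and $p_{V_0,V_1,V_2|X}$ such that, for $(V_0,V_1,V_2,X,Y_1,Y_2)\sim p_{V_0,V_1,V_2|X}\,p_X\,p_{Y_1,Y_2|X}$ and $m=\min\{I(V_0;Y_1),I(V_0;Y_2)\}$, \begin{align*} &H(S_0)\le\kappa m,\qquad H(S_i)\le\kappa[m+I(V_i;Y_i|V_0)],\quad i=1,2,\\ &H(S_1,S_2)\le\kappa[m+I(V_1;Y_1|V_0)+I(X;Y_2|V_0,V_1)],\\ &H(S_1,S_2)\le\kappa[m+I(V_2;Y_2|V_0)+I(X;Y_1|V_0,V_2)].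 \end{align*} The *new condition* holds if there is a distribution $p_X$ such that for every $p_{U,(S_1,S_2)}=p_{U|(S_1,S_2)}p_{(S_1,S_2)}$ there is $p_{V_0,V_1,V_2|X}$ such that, for $(V_0,V_1,V_2,X,Y_1,Y_2)\sim p_{V_0,V_1,V_2|X}\,p_X\,p_{Y_1,Y_2|X}$, \begin{align*} &I(U;S_i)\le\kappa I(V_0;Y_i),\qquad H(S_i)\le\kappa I(V_0,V_i;Y_i),\quad i=1,2,\\ &I(U;S_1)+H(S_2|U)\le\kappa[I(V_0;Y_1)+I(V_2;Y_2|V_0)],\\ &I(U;S_2)+H(S_1|U)\le\kappa[I(V_0;Y_2)+I(V_1;Y_1|V_0)],\\ &I(U;S_1)+H(S_1,S_2|U)\le\kappa[I(V_0,V_1;Y_1)+I(X;Y_2|V_0,V_1)],\\ &I(U;S_2)+H(S_1,S_2|U)\le\kappa[I(V_0,V_2;Y_2)+I(X;Y_1|V_0,V_2)],\\ &I(U;S_1)+H(S_1,S_2|U)\le\kappa[I(V_0;Y_1)+I(V_2;Y_2|V_0)+I(X;Y_1|V_0,V_2)],\\ &I(U;S_2)+H(S_1,S_2|U)\le\kappa[I(V_0;Y_2)+I(V_1;Y_1|V_0)+I(X;Y_2|V_0,V_1)].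 \end{align*} Both conditions are considered for $\kappa=1$ and the Blackwell channel, whose inputs $0,1,2$ produce the output pairs $(y_1,y_2)=(0,0),(1,1),(0,1)$, respectively, with probability one. Let $\alpha^*=H_b^{-1}(\log_23-\frac43)$ and $\mathcal I=[H_b^{-1}(\frac12\log_23-\frac23),\,\alpha^*)$. For $\alpha\in\mathcal I$ let $S_1=(\tilde S_0(\alpha),\tilde S_1)$ and $S_2=(\bar S_0(\alpha),\bar S_2)$, where all four components are $\{0,1\}$-valued, $(\tilde S_0(\alpha),\bar S_0(\alpha))$, $\tilde S_1$ and $\bar S_2$ are mutually independent, $\Pr(\tilde S_1=0)=\Pr(\bar S_2=0)=H_b^{-1}(\frac23)$, and $(\tilde S_0(\alpha),\bar S_0(\alpha))$ takes the values $(0,0),(0,1),(1,0),(1,1)$ with probabilities $\alpha(1-\beta),\ \alpha\beta,\ \alpha\beta,\ 1-\alpha-\alpha\beta$, where $\beta=\beta(\alpha)\in(0,1-\alpha]$ is such that $H(\tilde S_0(\alpha),\bar S_0(\alpha))=\log_23-\frac43$. Then: 1. $\mathcal I$ is non-empty, and for every $\alpha\in\mathcal I$ there is exactly one such $\beta(\alpha)$.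 2. For every $\alpha\in\mathcal I$, the above is a probability distribution $p_{(S_1,S_2)}$, the sources have no non-trivial common part ($H(S_0)=0$), and $p_{(S_1,S_2)}$ satisfies the Gohari-Anantharam condition. 3. There is $\delta>0$ such that for every $\alpha\in\mathcal I$ with $\alpha>\alpha^*-\delta$, $p_{(S_1,S_2)}$ violates the new condition. 4. Consequently the new outer bound is strictly tighter: the set of distributions on $\{0,1\}^2\times\{0,1\}^2$ that satisfy the new condition is a proper subset of the set of those that satisfy the Gohari-Anantharam condition. -/

import Mathlib

noncomputable section

namespace CorrBC

/-! Shannon information measures (in bits) of random variables on a finite probability space,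
given by its mass function `P : Ω → ℝ`. -/

section Information

variable {Ω A B C : Type*}

open Classical in
/-- The probability that the random variable `F` takes the value `a`. -/
def law [Fintype Ω] (P : Ω → ℝ) (F : Ω → A) (a : A) : ℝ := ∑ ω, if F ω = a then P ω else 0

/-- The random variable `(F, G)`. -/
def pair (F : Ω → A) (G : Ω → B) : Ω → A × B := fun ω => (F ω, G ω)

/-- `H(F)`. -/
def ent [Fintype Ω] [Fintype A] (P : Ω → ℝ) (F : Ω → A) : ℝ := ∑ a, Real.negMulLog (law P F a) / Real.log 2

/-- `H(F | G) = H(F, G) - H(G)`. -/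
def condEnt [Fintype Ω] [Fintype A] [Fintype B] (P : Ω → ℝ) (F : Ω → A) (G : Ω → B) : ℝ := ent P (pair F G) - ent P G

/-- `I(F; G) = H(F) - H(F | G)`. -/
def mutInfo [Fintype Ω] [Fintype A] [Fintype B] (P : Ω → ℝ) (F : Ω → A) (G : Ω → B) : ℝ := ent P F - condEnt P F G

/-- `I(F; G | K) = H(F | K) - H(F | G, K)`. -/
def condMutInfo [Fintype Ω] [Fintype A] [Fintype B] [Fintype C]
    (P : Ω → ℝ) (F : Ω → A) (G : Ω → B) (K : Ω → C) : ℝ :=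
  condEnt P F K - condEnt P F (pair G K)

end Information

/-- The binary entropy function `H_b`, in bits. -/
def binEnt (t : ℝ) : ℝ := Real.binEntropy t / Real.log 2

/-- The inverse `H_b⁻¹ : [0, 1] → [0, 1/2]` of the binary entropy function. -/
def binEntInv (h : ℝ) : ℝ := Function.invFunOn binEnt (Set.Icc 0 (1 / 2)) h

/-! The common part of two correlated sources. -/

section CommonPart

variable {S₁ S₂ : Type*}

/-- The bipartite graph on the disjoint union of the two alphabets in which `s₁` and `s₂` are
adjacent when `p (s₁, s₂)` is not zero. -/
def supportGraph (p : S₁ × S₂ → ℝ) : SimpleGraph (S₁ ⊕ S₂) :=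
  SimpleGraph.fromRel fun a b => ∃ s₁ s₂, a = Sum.inl s₁ ∧ b = Sum.inr s₂ ∧ p (s₁, s₂) ≠ 0

/-- The alphabet of the common part. -/
def CommonAlphabet (p : S₁ × S₂ → ℝ) : Type _ := (supportGraph p).ConnectedComponent

instance commonAlphabetFintype [Fintype S₁] [Fintype S₂] (p : S₁ × S₂ → ℝ) :
    Fintype (CommonAlphabet p) :=
  haveI : Finite (CommonAlphabet p) :=
    Finite.of_surjective (fun a : S₁ ⊕ S₂ => (supportGraph p).connectedComponentMk a)
      (fun c => Quot.exists_rep c)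
  Fintype.ofFinite _

/-- The common part `S₀` of `(S₁, S₂)` (Gács-Körner, Witsenhausen): the connected component of
`S₁`, which is almost surely also the connected component of `S₂`. -/
def commonPart (p : S₁ × S₂ → ℝ) (s : S₁ × S₂) : CommonAlphabet p :=
  (supportGraph p).connectedComponentMk (Sum.inl s.1)

end CommonPart

/-! The two outer bounds. A channel `W` from `A` to `B` is given by the probabilities `W a b`
of the output `b` given the input `a`. -/

/-- `W` is a conditional distribution on `B` given `A`. -/
def IsChannel {A B : Type*} [Fintype B] (W : A → B → ℝ) : Prop := ∀ a, W a ∈ stdSimplex ℝ B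

section Bounds

variable {S₁ S₂ X Y₁ Y₂ : Type}

/-- The joint distribution `p_{V₀,V₁,V₂|X} p_X p_{Y₁,Y₂|X}` of `(V₀, V₁, V₂, X, Y₁, Y₂)`. -/
def testLaw {V₀ V₁ V₂ : Type} (q : X → V₀ × V₁ × V₂ → ℝ) (pX : X → ℝ) (W : X → Y₁ × Y₂ → ℝ) :
    V₀ × V₁ × V₂ × X × Y₁ × Y₂ → ℝ :=
  fun (v₀, v₁, v₂, x, y₁, y₂) => q x (v₀, v₁, v₂) * pX x * W x (y₁, y₂)

/-- The joint distribution `p_{U|(S₁,S₂)} p_{(S₁,S₂)}` of `(U, S₁, S₂)`. -/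
def sourceLaw {U : Type} (r : S₁ × S₂ → U → ℝ) (p : S₁ × S₂ → ℝ) : U × S₁ × S₂ → ℝ :=
  fun (u, s₁, s₂) => r (s₁, s₂) u * p (s₁, s₂)

/-- The necessary condition of Gohari and Anantharam for the source distribution `p` to be
admissible for the broadcast channel `W` subject to the bandwidth expansion constraint `κ`. -/
def GohariAnantharam [Fintype S₁] [Fintype S₂] [Fintype X] [Fintype Y₁] [Fintype Y₂]
    (p : S₁ × S₂ → ℝ) (W : X → Y₁ × Y₂ → ℝ) (κ : ℝ) : Prop :=
  ∃ (V₀ V₁ V₂ : Type) (_ : Fintype V₀) (_ : Fintype V₁) (_ : Fintype V₂)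
    (pX : X → ℝ) (q : X → V₀ × V₁ × V₂ → ℝ), pX ∈ stdSimplex ℝ X ∧ IsChannel q ∧
    let P := testLaw q pX W
    let v₀ : V₀ × V₁ × V₂ × X × Y₁ × Y₂ → V₀ := fun ω => ω.1
    let v₁ : V₀ × V₁ × V₂ × X × Y₁ × Y₂ → V₁ := fun ω => ω.2.1
    let v₂ : V₀ × V₁ × V₂ × X × Y₁ × Y₂ → V₂ := fun ω => ω.2.2.1
    let x : V₀ × V₁ × V₂ × X × Y₁ × Y₂ → X := fun ω => ω.2.2.2.1
    let y₁ : V₀ × V₁ × V₂ × X × Y₁ × Y₂ → Y₁ := fun ω => ω.2.2.2.2.1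
    let y₂ : V₀ × V₁ × V₂ × X × Y₁ × Y₂ → Y₂ := fun ω => ω.2.2.2.2.2
    let m := min (mutInfo P v₀ y₁) (mutInfo P v₀ y₂)
    ent p (commonPart p) ≤ κ * m ∧
    ent p Prod.fst ≤ κ * (m + condMutInfo P v₁ y₁ v₀) ∧
    ent p Prod.snd ≤ κ * (m + condMutInfo P v₂ y₂ v₀) ∧
    ent p id ≤ κ * (m + condMutInfo P v₁ y₁ v₀ + condMutInfo P x y₂ (pair v₀ v₁)) ∧
    ent p id ≤ κ * (m + condMutInfo P v₂ y₂ v₀ + condMutInfo P x y₁ (pair v₀ v₂))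

/-- The new necessary condition for the source distribution `p` to be admissible for the
broadcast channel `W` subject to the bandwidth expansion constraint `κ`. -/
def NewBound [Fintype S₁] [Fintype S₂] [Fintype X] [Fintype Y₁] [Fintype Y₂]
    (p : S₁ × S₂ → ℝ) (W : X → Y₁ × Y₂ → ℝ) (κ : ℝ) : Prop :=
  ∃ pX ∈ stdSimplex ℝ X, ∀ (U : Type) (_ : Fintype U) (r : S₁ × S₂ → U → ℝ), IsChannel r →
  ∃ (V₀ V₁ V₂ : Type) (_ : Fintype V₀) (_ : Fintype V₁) (_ : Fintype V₂)
    (q : X → V₀ × V₁ × V₂ → ℝ), IsChannel q ∧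
    let Q := sourceLaw r p
    let u : U × S₁ × S₂ → U := fun ω => ω.1
    let s₁ : U × S₁ × S₂ → S₁ := fun ω => ω.2.1
    let s₂ : U × S₁ × S₂ → S₂ := fun ω => ω.2.2
    let P := testLaw q pX W
    let v₀ : V₀ × V₁ × V₂ × X × Y₁ × Y₂ → V₀ := fun ω => ω.1
    let v₁ : V₀ × V₁ × V₂ × X × Y₁ × Y₂ → V₁ := fun ω => ω.2.1
    let v₂ : V₀ × V₁ × V₂ × X × Y₁ × Y₂ → V₂ := fun ω => ω.2.2.1
    let x : V₀ × V₁ × V₂ × X × Y₁ × Y₂ → X := fun ω => ω.2.2.2.1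
    let y₁ : V₀ × V₁ × V₂ × X × Y₁ × Y₂ → Y₁ := fun ω => ω.2.2.2.2.1
    let y₂ : V₀ × V₁ × V₂ × X × Y₁ × Y₂ → Y₂ := fun ω => ω.2.2.2.2.2
    mutInfo Q u s₁ ≤ κ * mutInfo P v₀ y₁ ∧
    mutInfo Q u s₂ ≤ κ * mutInfo P v₀ y₂ ∧
    ent Q s₁ ≤ κ * mutInfo P (pair v₀ v₁) y₁ ∧
    ent Q s₂ ≤ κ * mutInfo P (pair v₀ v₂) y₂ ∧
    mutInfo Q u s₁ + condEnt Q s₂ u ≤ κ * (mutInfo P v₀ y₁ + condMutInfo P v₂ y₂ v₀) ∧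
    mutInfo Q u s₂ + condEnt Q s₁ u ≤ κ * (mutInfo P v₀ y₂ + condMutInfo P v₁ y₁ v₀) ∧
    mutInfo Q u s₁ + condEnt Q (pair s₁ s₂) u ≤
      κ * (mutInfo P (pair v₀ v₁) y₁ + condMutInfo P x y₂ (pair v₀ v₁)) ∧
    mutInfo Q u s₂ + condEnt Q (pair s₁ s₂) u ≤
      κ * (mutInfo P (pair v₀ v₂) y₂ + condMutInfo P x y₁ (pair v₀ v₂)) ∧
    mutInfo Q u s₁ + condEnt Q (pair s₁ s₂) u ≤
      κ * (mutInfo P v₀ y₁ + condMutInfo P v₂ y₂ v₀ + condMutInfo P x y₁ (pair v₀ v₂)) ∧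
    mutInfo Q u s₂ + condEnt Q (pair s₁ s₂) u ≤
      κ * (mutInfo P v₀ y₂ + condMutInfo P v₁ y₁ v₀ + condMutInfo P x y₂ (pair v₀ v₁))

end Bounds

/-! The example. -/

/-- The Blackwell channel: the inputs `0`, `1`, `2` produce the output pairs `(0, 0)`, `(1, 1)`,
`(0, 1)` with probability one. -/
def blackwell : Fin 3 → Fin 2 × Fin 2 → ℝ :=
  fun x y => if (x, y) ∈ ({(0, (0, 0)), (1, (1, 1)), (2, (0, 1))} : Finset (Fin 3 × Fin 2 × Fin 2))
    then 1 else 0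

/-- The distribution on `{0, 1}` that gives probability `t` to `0`. -/
def binary (t : ℝ) : Fin 2 → ℝ := ![t, 1 - t]

/-- The joint distribution of two binary variables that both take the value `0` with probability
`α` and such that either of them takes the value `1` with conditional probability `β` when the
other one is `0`. -/
def coupled (α β : ℝ) : Fin 2 × Fin 2 → ℝ :=
  fun s => ![![α * (1 - β), α * β], ![α * β, 1 - α - α * β]] s.1 s.2

/-- `β` lies in `(0, 1 - α]` and the entropy of `coupled α β` is `log₂ 3 - 4/3`. -/
def IsBeta (α β : ℝ) : Prop :=
  β ∈ Set.Ioc 0 (1 - α) ∧ ent (coupled α β) id = Real.logb 2 3 - 4 / 3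

/-- The distribution of the pair of sources `S₁ = (a, c)`, `S₂ = (b, d)`, where `(a, b)`, `c`, `d`
are independent, `(a, b)` is distributed according to `coupled α β`, and `c`, `d` are binary with
entropy `2/3`. -/
def exampleSource (α β : ℝ) : (Fin 2 × Fin 2) × (Fin 2 × Fin 2) → ℝ :=
  fun (s₁, s₂) => coupled α β (s₁.1, s₂.1) * binary (binEntInv (2 / 3)) s₁.2 *
    binary (binEntInv (2 / 3)) s₂.2

/-- The right end of the parameter interval. -/
def alphaMax : ℝ := binEntInv (Real.logb 2 3 - 4 / 3)

/-- The parameter interval. -/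
def alphaRange : Set ℝ := Set.Ico (binEntInv (Real.logb 2 3 / 2 - 2 / 3)) alphaMax

end CorrBC

end

open CorrBC

/-! The sources are tuned so that $H(S_1,S_2)=\log_2 3$, the largest possible joint output entropy
of the Blackwell channel, while $H(S_i)=H_b(\alpha)+\frac23$ stays below $\log_2 3-\frac23$, the
entropy of either output under uniform input. With uniform $X$, constant $V_0$ and $V_i=Y_i$, the
Gohari-Anantharam inequalities therefore hold; the common part is trivial because the source has
full support.

The new condition fails for $U=\tilde S_0$. It demands $I(V_0;Y_1)\ge I(U;S_1)=H_b(\alpha)$. Two of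
its sum-rate inequalities, relaxed by `mutInfo_add_condMutInfo_le`, force
$H(Y_1)+H(X|V_0,Y_1)\ge\log_2 3$ and $H(Y_2)+H(X|V_0,Y_2)\ge H_b(\alpha)+\frac43$, so the two
deficits from $\log_2 3$ add up to at most $\log_2 3-\frac43-H_b(\alpha)$. The stability estimate
`blackwell_mutInfo_le` says that $I(V_0;Y_1)$ is at most 10 times the sum of the deficits: when both
are small, $X$ is nearly uniform given most values of $V_0$. Hence $H_b(\alpha)\le 10(\log_2
3-\frac43-H_b(\alpha))$ (`binEnt_le_of_newBound`). As $\alpha\to\alpha^*$ the right side tends to 0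
and the left side to $\log_2 3-\frac43>0$, a contradiction.

The inclusion of the two sets comes from letting $U$ be the common part, and the example makes it
proper. -/

noncomputable section

namespace CorrBC

/-! ### Shannon entropy: chain rules, Gibbs' inequality, submodularity -/

section InformationLemmas

variable {Ω Ω' A B C : Type*} [Fintype Ω] [Fintype Ω']

theorem law_nonneg {P : Ω → ℝ} (hP : ∀ ω, 0 ≤ P ω) (F : Ω → A) (a : A) : 0 ≤ law P F a :=
  Finset.sum_nonneg fun ω _ => by split_ifs <;> simp [hP]

theorem law_pos {P : Ω → ℝ} (hP : ∀ ω, 0 ≤ P ω) (F : Ω → A) {ω : Ω} (h : 0 < P ω) :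
    0 < law P F (F ω) := by
  classical
  refine h.trans_le ?_
  have := Finset.single_le_sum (f := fun ω' => if F ω' = F ω then P ω' else 0) (s := Finset.univ)
    (fun ω' _ => by split_ifs <;> simp [hP]) (Finset.mem_univ ω)
  simpa [law] using this

theorem law_id (P : Ω → ℝ) : law P id = P := by
  funext a
  classical
  simp [law]

theorem law_mul (P : Ω → ℝ) (Q : Ω' → ℝ) (F : Ω → A) (G : Ω' → B) (c : A × B) :
    law (fun ω : Ω × Ω' => P ω.1 * Q ω.2) (pair (F ∘ Prod.fst) (G ∘ Prod.snd)) c =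
      law P F c.1 * law Q G c.2 := by
  classical
  obtain ⟨a, b⟩ := c
  simp only [law, pair, Function.comp, Fintype.sum_prod_type, Prod.mk.injEq,
    Finset.sum_mul_sum]
  refine Finset.sum_congr rfl fun _ _ => Finset.sum_congr rfl fun _ _ => ?_
  split_ifs <;> simp_all

variable [Fintype A]

theorem sum_law_mul (P : Ω → ℝ) (F : Ω → A) (g : A → ℝ) :
    ∑ a, law P F a * g a = ∑ ω, P ω * g (F ω) := by
  classical
  simp only [law, Finset.sum_mul, ite_mul, zero_mul]
  rw [Finset.sum_comm]
  simp

theorem law_law (P : Ω → ℝ) (e : Ω → A) (F : A → B) : law (law P e) F = law P (F ∘ e) := by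
  classical
  funext b
  have := sum_law_mul P e (fun a => if F a = b then 1 else 0)
  simpa [law] using this

variable [Fintype B] [Fintype C]

theorem sum_law (P : Ω → ℝ) (F : Ω → A) : ∑ a, law P F a = ∑ ω, P ω := by
  simpa using sum_law_mul P F (fun _ => 1)

theorem ent_law (P : Ω → ℝ) (e : Ω → A) (F : A → B) : ent (law P e) F = ent P (F ∘ e) := by
  simp only [ent, law_law]

theorem ent_eq_sum (P : Ω → ℝ) (F : Ω → A) :
    ent P F = -(∑ ω, P ω * Real.log (law P F (F ω))) / Real.log 2 := by
  rw [ent, ← Finset.sum_div, ← sum_law_mul P F (fun a => Real.log (law P F a)),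
    ← Finset.sum_neg_distrib]
  simp only [Real.negMulLog, neg_mul]

/-- Entropy depends only on the almost sure partition that a random variable induces. -/
theorem ent_congr {P : Ω → ℝ} {F : Ω → A} {G : Ω → B}
    (h : ∀ ω ω', P ω ≠ 0 → P ω' ≠ 0 → (F ω = F ω' ↔ G ω = G ω')) : ent P F = ent P G := by
  classical
  rw [ent_eq_sum, ent_eq_sum]
  congr 2
  refine Finset.sum_congr rfl fun ω _ => ?_
  by_cases hω : P ω = 0
  · simp [hω]
  · congr 2
    refine Finset.sum_congr rfl fun ω' _ => ?_
    by_cases hω' : P ω' = 0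
    · simp [hω']
    · simp only [h ω' ω hω' hω]

theorem mutInfo_pair (P : Ω → ℝ) (F : Ω → A) (G : Ω → B) (K : Ω → C) :
    mutInfo P (pair F G) K = mutInfo P F K + condMutInfo P G K F := by
  have h1 : ent P (pair F G) = ent P (pair G F) :=
    ent_congr fun _ _ _ _ => by simp only [pair, Prod.mk.injEq]; tauto
  have h2 : ent P (pair (pair F G) K) = ent P (pair G (pair K F)) :=
    ent_congr fun _ _ _ _ => by simp only [pair, Prod.mk.injEq]; tauto
  have h3 : ent P (pair F K) = ent P (pair K F) :=
    ent_congr fun _ _ _ _ => by simp only [pair, Prod.mk.injEq]; tauto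
  simp only [mutInfo, condMutInfo, condEnt, h1, h2, h3]
  ring

theorem ent_of_const {P : Ω → ℝ} (hP : ∑ ω, P ω = 1) {F : Ω → A}
    (h : ∀ ω ω', P ω ≠ 0 → P ω' ≠ 0 → F ω = F ω') : ent P F = 0 := by
  rw [ent_congr (G := fun _ => ()) (by simpa using h)]
  simp [ent, law, hP]

theorem ent_mul {P : Ω → ℝ} {Q : Ω' → ℝ} (hP : ∑ ω, P ω = 1) (hQ : ∑ ω, Q ω = 1)
    (F : Ω → A) (G : Ω' → B) :
    ent (fun ω : Ω × Ω' => P ω.1 * Q ω.2) (pair (F ∘ Prod.fst) (G ∘ Prod.snd)) =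
      ent P F + ent Q G := by
  simp only [ent, law_mul, Real.negMulLog_mul, add_div, Finset.sum_add_distrib,
    Fintype.sum_prod_type, mul_div_assoc, ← Finset.sum_mul, ← Finset.mul_sum, sum_law, hP, hQ,
    one_mul]

/-- One term of Gibbs' inequality: $\log t\le t-1$ at $t=y/x$. The last hypothesis is absolute
continuity, needed because `Real.log 0 = 0`. -/
theorem negMulLog_add_mul_log_le {x y : ℝ} (hx : 0 ≤ x) (hy : 0 ≤ y) (h : x ≠ 0 → y ≠ 0) :
    Real.negMulLog x + x * Real.log y ≤ y - x := by
  rcases hx.eq_or_lt with rfl | hx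
  · simpa
  · have hy' : 0 < y := hy.lt_of_ne' (h hx.ne')
    have h1 := Real.log_le_sub_one_of_pos (div_pos hy' hx)
    rw [Real.log_div hy'.ne' hx.ne'] at h1
    have h2 := mul_le_mul_of_nonneg_left h1 hx.le
    have h3 : x * (y / x - 1) = y - x := by field_simp
    rw [Real.negMulLog]
    linarith

theorem ent_le_ent_pair {P : Ω → ℝ} (hP : ∀ ω, 0 ≤ P ω) (F : Ω → A) (G : Ω → B) :
    ent P F ≤ ent P (pair F G) := by
  classical
  rw [ent_eq_sum, ent_eq_sum]
  refine div_le_div_of_nonneg_right (neg_le_neg (Finset.sum_le_sum fun ω _ => ?_))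
    (Real.log_nonneg one_le_two)
  rcases (hP ω).eq_or_lt with h | h
  · simp [← h]
  · refine mul_le_mul_of_nonneg_left (Real.log_le_log (law_pos hP (pair F G) h) ?_) h.le
    refine Finset.sum_le_sum fun ω' _ => ?_
    have := hP ω'
    simp only [pair, Prod.mk.injEq]
    split_ifs <;> simp_all

/-- Strong subadditivity of entropy. -/
theorem ent_submodular {P : Ω → ℝ} (hP : ∀ ω, 0 ≤ P ω) (F : Ω → A) (G : Ω → B) (K : Ω → C) :
    ent P (pair F (pair G K)) + ent P K ≤ ent P (pair F K) + ent P (pair G K) := by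
  classical
  set f : A → C → ℝ := fun a c => law P (pair F K) (a, c) with hf
  set g : B → C → ℝ := fun b c => law P (pair G K) (b, c) with hg
  set k : C → ℝ := fun c => law P K c with hk
  set t : A × B × C → ℝ := law P (pair F (pair G K)) with ht
  have hf0 : ∀ a c, 0 ≤ f a c := fun a c => law_nonneg hP _ _
  have hg0 : ∀ a c, 0 ≤ g a c := fun a c => law_nonneg hP _ _
  have hk0 : ∀ c, 0 ≤ k c := fun c => law_nonneg hP _ _
  have hfk : ∀ c, ∑ a, f a c = k c := fun c => by
    simp only [hf, hk, law, pair, Prod.mk.injEq]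
    rw [Finset.sum_comm]
    refine Finset.sum_congr rfl fun ω _ => ?_
    by_cases h : K ω = c <;> simp [h]
  have hgk : ∀ c, ∑ a, g a c = k c := fun c => by
    simp only [hg, hk, law, pair, Prod.mk.injEq]
    rw [Finset.sum_comm]
    refine Finset.sum_congr rfl fun ω _ => ?_
    by_cases h : K ω = c <;> simp [h]
  have hpos : ∀ x : A × B × C, t x ≠ 0 → 0 < f x.1 x.2.2 ∧ 0 < g x.2.1 x.2.2 ∧ 0 < k x.2.2 := by
    intro x hx
    obtain ⟨ω, -, hω⟩ := Finset.exists_ne_zero_of_sum_ne_zero (s := Finset.univ) hx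
    split_ifs at hω with h
    · have h0 : 0 < P ω := (hP ω).lt_of_ne' hω
      subst h
      exact ⟨law_pos hP (pair F K) h0, law_pos hP (pair G K) h0, law_pos hP K h0⟩
    · exact absurd rfl hω
  -- The comparison mass $f g/k$ makes the first two variables conditionally independent given the
  -- third. Cells with $k=0$ are harmless, since $k\cdot k/k=k$ there too.
  have hsum : ∑ x : A × B × C, f x.1 x.2.2 * g x.2.1 x.2.2 / k x.2.2 = ∑ ω, P ω := by
    rw [← sum_law P K]
    simp only [Fintype.sum_prod_type]
    calc _ = ∑ a, ∑ c, ∑ b, f a c * g b c / k c :=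
          Finset.sum_congr rfl fun _ _ => Finset.sum_comm
      _ = ∑ c, ∑ a, ∑ b, f a c * g b c / k c := Finset.sum_comm
      _ = _ := Finset.sum_congr rfl fun c _ => by
          simp only [← Finset.sum_div, ← Finset.mul_sum, ← Finset.sum_mul, hfk, hgk]
          exact mul_self_div_self _
  -- Gibbs' inequality for the joint law against the conditionally independent one, that is,
  -- nonnegativity of the conditional mutual information.
  have key : ∑ x : A × B × C, (Real.negMulLog (t x) +
      t x * Real.log (f x.1 x.2.2 * g x.2.1 x.2.2 / k x.2.2)) ≤ 0 := by
    refine (Finset.sum_le_sum fun x _ => negMulLog_add_mul_log_le (law_nonneg hP _ _) ?_ ?_).trans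
      (b := ∑ x : A × B × C, (f x.1 x.2.2 * g x.2.1 x.2.2 / k x.2.2 - t x)) ?_
    · exact div_nonneg (mul_nonneg (hf0 _ _) (hg0 _ _)) (hk0 _)
    · intro hx
      obtain ⟨h1, h2, h3⟩ := hpos x hx
      positivity
    · rw [Finset.sum_sub_distrib, hsum, ht, sum_law, sub_self]
  have hlog : ∀ x : A × B × C, t x * Real.log (f x.1 x.2.2 * g x.2.1 x.2.2 / k x.2.2) =
      t x * (Real.log (f x.1 x.2.2) + Real.log (g x.2.1 x.2.2) - Real.log (k x.2.2)) := by
    intro x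
    by_cases hx : t x = 0
    · simp [hx]
    · obtain ⟨h1, h2, h3⟩ := hpos x hx
      rw [Real.log_div (by positivity) h3.ne', Real.log_mul h1.ne' h2.ne']
  rw [Finset.sum_add_distrib, Finset.sum_congr rfl fun x _ => hlog x, ht, sum_law_mul] at key
  simp only [mul_add, mul_sub, Finset.sum_add_distrib, Finset.sum_sub_distrib] at key
  rw [ent_eq_sum P K, ent_eq_sum P (pair F K), ent_eq_sum P (pair G K), ent, ← Finset.sum_div,
    ← add_div, ← add_div]
  refine div_le_div_of_nonneg_right ?_ (Real.log_nonneg one_le_two)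
  simp only [hf, hg, hk] at key
  simp only [pair] at key ⊢
  linarith

end InformationLemmas

/-! ### The Blackwell channel and its stability estimate -/

section Blackwell

/-- The first output of the Blackwell channel. -/
def out₁ : Fin 3 → Fin 2 := ![0, 1, 0]

/-- The second output of the Blackwell channel. -/
def out₂ : Fin 3 → Fin 2 := ![0, 1, 1]

theorem out_injective {x x' : Fin 3} (h₁ : out₁ x = out₁ x') (h₂ : out₂ x = out₂ x') :
    x = x' := by
  revert x x'
  decide

theorem blackwell_eq (x : Fin 3) (y : Fin 2 × Fin 2) :
    blackwell x y = if (out₁ x, out₂ x) = y then 1 else 0 := by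
  obtain ⟨y₁, y₂⟩ := y
  unfold blackwell
  congr 1
  rw [eq_iff_iff]
  revert x y₁ y₂
  decide

theorem isChannel_blackwell : IsChannel blackwell := fun x =>
  ⟨fun y => by rw [blackwell_eq]; split_ifs <;> norm_num, by simp [blackwell_eq]⟩

theorem testLaw_nonneg {V₀ V₁ V₂ X Y₁ Y₂ : Type} [Fintype V₀] [Fintype V₁] [Fintype V₂]
    [Fintype X] [Fintype Y₁] [Fintype Y₂] {q : X → V₀ × V₁ × V₂ → ℝ} {pX : X → ℝ}
    {W : X → Y₁ × Y₂ → ℝ} (hq : IsChannel q) (hpX : pX ∈ stdSimplex ℝ X) (hW : IsChannel W)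
    (ω : V₀ × V₁ × V₂ × X × Y₁ × Y₂) : 0 ≤ testLaw q pX W ω :=
  mul_nonneg (mul_nonneg ((hq _).1 _) (hpX.1 _)) ((hW _).1 _)

theorem sum_testLaw {V₀ V₁ V₂ X Y₁ Y₂ : Type} [Fintype V₀] [Fintype V₁] [Fintype V₂]
    [Fintype X] [Fintype Y₁] [Fintype Y₂] {q : X → V₀ × V₁ × V₂ → ℝ} {pX : X → ℝ}
    {W : X → Y₁ × Y₂ → ℝ} (hq : IsChannel q) (hpX : pX ∈ stdSimplex ℝ X) (hW : IsChannel W) :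
    ∑ ω, testLaw q pX W ω = 1 := by
  let e : X × (V₀ × V₁ × V₂) × Y₁ × Y₂ ≃ V₀ × V₁ × V₂ × X × Y₁ × Y₂ :=
    ⟨fun z => (z.2.1.1, z.2.1.2.1, z.2.1.2.2, z.1, z.2.2), fun z => (z.2.2.2.1,
      (z.1, z.2.1, z.2.2.1), z.2.2.2.2), fun _ => rfl, fun _ => rfl⟩
  have : ∀ z, testLaw q pX W (e z) = q z.1 z.2.1 * pX z.1 * W z.1 z.2.2 := fun _ => rfl
  rw [← e.sum_comp]
  simp only [this]
  rw [Fintype.sum_prod_type, ← hpX.2]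
  refine Finset.sum_congr rfl fun x _ => ?_
  rw [Fintype.sum_prod_type]
  simp only [← Finset.mul_sum, (hW x).2, mul_one, ← Finset.sum_mul, (hq x).2, one_mul]

theorem testLaw_blackwell_support {V₀ V₁ V₂ : Type} {q : Fin 3 → V₀ × V₁ × V₂ → ℝ}
    {pX : Fin 3 → ℝ} {ω : V₀ × V₁ × V₂ × Fin 3 × Fin 2 × Fin 2}
    (h : testLaw q pX blackwell ω ≠ 0) :
    ω.2.2.2.2.1 = out₁ ω.2.2.2.1 ∧ ω.2.2.2.2.2 = out₂ ω.2.2.2.1 := by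
  have := right_ne_zero_of_mul h
  rw [blackwell_eq] at this
  split_ifs at this with h'
  · rw [Prod.ext_iff] at h'
    exact ⟨h'.1.symm, h'.2.symm⟩
  · exact absurd rfl this

/-- With deterministic auxiliaries everything is a function of $X$, so entropies under the test law
become entropies under `pX`. -/
theorem testLaw_ite {V₀ V₁ V₂ : Type} [DecidableEq (V₀ × V₁ × V₂)] (g : Fin 3 → V₀ × V₁ × V₂)
    (pX : Fin 3 → ℝ) :
    testLaw (fun x v => if g x = v then 1 else 0) pX blackwell =
      law pX fun x => ((g x).1, (g x).2.1, (g x).2.2, x, out₁ x, out₂ x) := by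
  classical
  funext ⟨v₀, v₁, v₂, x, y₁, y₂⟩
  rw [law, Finset.sum_eq_single x]
  · simp only [testLaw, blackwell_eq, Prod.ext_iff]
    split_ifs <;> simp_all
  · rintro x' - h
    rw [if_neg]
    simp only [Prod.mk.injEq]
    tauto
  · simp

theorem sourceLaw_ite {S₁ S₂ U : Type} [Fintype S₁] [Fintype S₂] [DecidableEq U]
    (g : S₁ × S₂ → U) (p : S₁ × S₂ → ℝ) :
    sourceLaw (fun s u => if g s = u then 1 else 0) p = law p fun s => (g s, s.1, s.2) := by
  classical
  funext ⟨u, s₁, s₂⟩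
  rw [law, Finset.sum_eq_single (s₁, s₂)]
  · simp [sourceLaw]
  · rintro ⟨s₁', s₂'⟩ - h
    rw [if_neg]
    simp only [ne_eq, Prod.mk.injEq, not_and] at h ⊢
    tauto
  · simp

theorem isChannel_ite {A B : Type*} [Fintype B] [DecidableEq B] (g : A → B) :
    IsChannel fun a b => if g a = b then (1 : ℝ) else 0 :=
  fun a => ⟨fun b => by dsimp only; split_ifs <;> norm_num, by simp⟩

/-- An upper bound on the entropy of the pair of cells of masses `a` and `c`. -/
theorem negMulLog_pair_le {a c : ℝ} (ha : 0 ≤ a) (hc : 0 ≤ c) {S : ℝ}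
    (h : a + c ≤ S) :
    Real.negMulLog a + Real.negMulLog c - Real.negMulLog (a + c) ≤
      Real.log 2 * (a + c) - (a - c) ^ 2 / (4 * S) := by
  rcases (add_nonneg ha hc).eq_or_lt with hs | hs
  · obtain rfl : a = 0 := by linarith
    obtain rfl : c = 0 := by linarith
    simp
  -- Applying $\log t\le t-1$ directly at the midpoint loses the quadratic term. Passing through
  -- $(3x+y)/4$, the average of $x$ and the midpoint, and using the inequality twice keeps half of
  -- the optimal quadratic term.
  have aux : ∀ x y : ℝ, 0 ≤ x → 0 ≤ y → 0 < x + y →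
      Real.negMulLog x + x * Real.log ((x + y) / 2) ≤
        (3 * x + y) / 4 - 2 * x + 2 * x * (x + y) / (3 * x + y) := by
    intro x y hx hy hxy
    have hz : 0 < (3 * x + y) / 4 := by linarith
    have h1 := negMulLog_add_mul_log_le hx hz.le fun _ => hz.ne'
    have h2 := Real.log_le_sub_one_of_pos (div_pos (half_pos hxy) hz)
    rw [Real.log_div (half_pos hxy).ne' hz.ne'] at h2
    have h3 := mul_le_mul_of_nonneg_left h2 hx
    have h4 : x * ((x + y) / 2 / ((3 * x + y) / 4) - 1) =
        2 * x * (x + y) / (3 * x + y) - x := by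
      have : 3 * x + y ≠ 0 := by linarith
      field_simp
      ring
    linarith
  have h1 := aux a c ha hc hs
  have h2 := aux c a hc ha (by linarith)
  rw [add_comm c a] at h2
  have h3 : Real.log ((a + c) / 2) = Real.log (a + c) - Real.log 2 :=
    Real.log_div hs.ne' two_ne_zero
  rw [h3] at h1 h2
  have h4 : 2 * a * (a + c) / (3 * a + c) + 2 * c * (a + c) / (3 * c + a) ≤
      (a + c) - (a - c) ^ 2 / (4 * (a + c)) := by
    have h5 : 0 < 3 * a + c := by linarith
    have h6 : 0 < 3 * c + a := by linarith
    rw [← sub_nonneg]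
    have : (a + c) - (a - c) ^ 2 / (4 * (a + c)) -
        (2 * a * (a + c) / (3 * a + c) + 2 * c * (a + c) / (3 * c + a)) =
        (a - c) ^ 4 / (4 * (a + c) * (3 * a + c) * (3 * c + a)) := by
      have h7 : (a + c) - (a - c) ^ 2 / (4 * (a + c)) =
          (4 * (a + c) ^ 2 - (a - c) ^ 2) / (4 * (a + c)) := by
        field_simp
      rw [h7, div_add_div _ _ h5.ne' h6.ne', div_sub_div _ _ (by positivity) (by positivity),
        div_eq_div_iff (by positivity) (by positivity)]
      ring
    rw [this]
    positivity
  have h7 : (a - c) ^ 2 / (4 * S) ≤ (a - c) ^ 2 / (4 * (a + c)) := by gcongr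
  have h8 : Real.negMulLog (a + c) = -(a + c) * Real.log (a + c) := rfl
  rw [h8]
  linarith

/-- A lower bound on the entropy of the pair of cells of masses `b` and `d`. -/
theorem le_negMulLog_pair {b d : ℝ} (hb : 0 ≤ b) (hd : 0 ≤ d) (hS : 0 < b + d) :
    Real.log 3 * (b + d) - Real.log 2 * d - (2 * b - d) ^ 2 / (2 * (b + d)) ≤
      Real.negMulLog b + Real.negMulLog d - Real.negMulLog (b + d) := by
  -- $\log t\le t-1$ at $t=x/y$. Used against the split of the total mass in ratio $1:2$, it bounds
  -- relative entropy by the chi-square divergence.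
  have aux : ∀ x y : ℝ, 0 ≤ x → 0 < y →
      -(x * Real.log y) - (x ^ 2 / y - x) ≤ Real.negMulLog x := by
    intro x y hx hy
    rcases hx.eq_or_lt with rfl | hx
    · simp
    have h1 := Real.log_le_sub_one_of_pos (div_pos hx hy)
    rw [Real.log_div hx.ne' hy.ne'] at h1
    have h2 := mul_le_mul_of_nonneg_left h1 hx.le
    have h3 : x * (x / y - 1) = x ^ 2 / y - x := by ring
    rw [Real.negMulLog]
    linarith
  have h1 := aux b ((b + d) / 3) hb (by linarith)
  have h2 := aux d (2 * (b + d) / 3) hd (by linarith)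
  rw [Real.log_div hS.ne' three_ne_zero] at h1
  rw [Real.log_div (by linarith) three_ne_zero, Real.log_mul two_ne_zero hS.ne'] at h2
  have h3 : b ^ 2 / ((b + d) / 3) - b + (d ^ 2 / (2 * (b + d) / 3) - d) =
      (2 * b - d) ^ 2 / (2 * (b + d)) := by
    field_simp
    ring
  have h8 : Real.negMulLog (b + d) = -(b + d) * Real.log (b + d) := rfl
  rw [h8]
  linarith

/-- Here $a,b,c$ are the masses of the inputs 0, 1, 2 for one value of $V$. Both sides vanish at
$a=b=c$ and are compared through quadratic forms: the left is at most $(2b-a-c)^2/(2S)$ and the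
brackets on the right are at least $(a-c)^2/(4S)$ and $(b-c)^2/(4S)$, where $S=a+b+c$. -/
theorem blackwell_cell {a b c : ℝ} (ha : 0 ≤ a) (hb : 0 ≤ b) (hc : 0 ≤ c) :
    Real.log 3 * (a + b + c) - Real.log 2 * (a + c) -
        (Real.negMulLog b + Real.negMulLog (a + c) - Real.negMulLog (a + b + c)) ≤
      10 * ((Real.log 2 * (a + c) -
          (Real.negMulLog a + Real.negMulLog c - Real.negMulLog (a + c))) +
        (Real.log 2 * (b + c) -
          (Real.negMulLog b + Real.negMulLog c - Real.negMulLog (b + c)))) := by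
  have hS : 0 ≤ a + b + c := by positivity
  rcases hS.eq_or_lt with hS | hS
  · obtain rfl : a = 0 := by linarith
    obtain rfl : b = 0 := by linarith
    obtain rfl : c = 0 := by linarith
    simp
  have h1 := le_negMulLog_pair hb (add_nonneg ha hc) (by linarith)
  have e : b + (a + c) = a + b + c := by ring
  rw [e] at h1
  have h2 := negMulLog_pair_le (S := a + b + c) ha hc (by linarith)
  have h3 := negMulLog_pair_le (S := a + b + c) hb hc (by linarith)
  have h4 : (2 * b - (a + c)) ^ 2 / (2 * (a + b + c)) ≤
      10 * ((a - c) ^ 2 / (4 * (a + b + c)) + (b - c) ^ 2 / (4 * (a + b + c))) := by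
    rw [← add_div, ← mul_div_assoc, div_le_div_iff₀ (by positivity) (by positivity)]
    -- Cauchy-Schwarz for $2b-a-c=2(b-c)-(a-c)$. The factor 5, with the denominators $2S$ and $4S$,
    -- gives the constant 10.
    have : (2 * b - (a + c)) ^ 2 ≤ 5 * ((a - c) ^ 2 + (b - c) ^ 2) := by
      nlinarith [sq_nonneg ((b - c) + 2 * (a - c))]
    nlinarith
  linarith

/-- If `X` and `(Y₁, Y₂)` determine each other, then the sum-rate bound on the left does not exceed
`H(Y₁) + H(X | F, Y₁)`. -/
theorem mutInfo_add_condMutInfo_le {Ω A B C D E : Type*} [Fintype Ω] [Fintype A] [Fintype B]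
    [Fintype C] [Fintype D] [Fintype E] {P : Ω → ℝ} (hP : ∀ ω, 0 ≤ P ω) (F : Ω → A) (G : Ω → B)
    (X : Ω → C) (Y₁ : Ω → D) (Y₂ : Ω → E)
    (h : ∀ ω ω', P ω ≠ 0 → P ω' ≠ 0 → (X ω = X ω' ↔ Y₁ ω = Y₁ ω' ∧ Y₂ ω = Y₂ ω')) :
    mutInfo P (pair F G) Y₁ + condMutInfo P X Y₂ (pair F G) ≤
      ent P Y₁ + ent P (pair F X) - ent P (pair F Y₁) := by
  -- The left side of the goal equals $H(Y_1)+H(Y_2,F,G)-H(F,G,Y_1)$. Adjoining $Y_1$ to the middle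
  -- term bounds this by $H(Y_1)+H(X|F,G,Y_1)$, and `h2` then drops $G$ from the conditioning.
  have h1 := ent_le_ent_pair hP (pair Y₂ (pair F G)) Y₁
  have h2 := ent_submodular hP G X (pair F Y₁)
  have e1 : ent P (pair X (pair Y₂ (pair F G))) = ent P (pair X (pair F G)) :=
    ent_congr fun ω ω' hω hω' => by
      simp only [pair, Prod.mk.injEq, h ω ω' hω hω']
      tauto
  have e2 : ent P (pair G (pair X (pair F Y₁))) = ent P (pair (pair Y₂ (pair F G)) Y₁) :=
    ent_congr fun ω ω' hω hω' => by
      simp only [pair, Prod.mk.injEq, h ω ω' hω hω']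
      tauto
  have e3 : ent P (pair G (pair F Y₁)) = ent P (pair (pair F G) Y₁) :=
    ent_congr fun ω ω' hω hω' => by
      simp only [pair, Prod.mk.injEq]
      tauto
  have e4 : ent P (pair X (pair F Y₁)) = ent P (pair F X) :=
    ent_congr fun ω ω' hω hω' => by
      simp only [pair, Prod.mk.injEq, h ω ω' hω hω']
      tauto
  simp only [mutInfo, condMutInfo, condEnt]
  linarith

/-- If the test channel nearly achieves the entropy bound `log₂ 3` in both orders of the outputs
of the Blackwell channel, then `V` is nearly independent of the first output. -/
theorem blackwell_mutInfo_le {V : Type*} [Fintype V] {w : V × Fin 3 → ℝ} (hw : ∀ v, 0 ≤ w v)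
    (hsum : ∑ v, w v = 1) :
    mutInfo w Prod.fst (out₁ ∘ Prod.snd) ≤
      10 * ((Real.logb 2 3 - (ent w (out₁ ∘ Prod.snd) + ent w id -
          ent w (pair Prod.fst (out₁ ∘ Prod.snd)))) +
        (Real.logb 2 3 - (ent w (out₂ ∘ Prod.snd) + ent w id -
          ent w (pair Prod.fst (out₂ ∘ Prod.snd))))) := by
  classical
  have hlog : 0 < Real.log 2 := Real.log_pos one_lt_two
  set f := Real.negMulLog with hf
  have e0 : ent w Prod.fst = (∑ v, f (w (v, 0) + w (v, 1) + w (v, 2))) / Real.log 2 := by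
    simp [ent, law, Fintype.sum_prod_type, Fin.sum_univ_three, Finset.sum_div, hf,
      Finset.sum_add_distrib]
  have eid : ent w id = (∑ v, (f (w (v, 0)) + f (w (v, 1)) + f (w (v, 2)))) / Real.log 2 := by
    rw [ent, law_id, ← Finset.sum_div, Fintype.sum_prod_type]
    simp [Fin.sum_univ_three, hf]
  have e1 : ent w (pair Prod.fst (out₁ ∘ Prod.snd)) =
      (∑ v, (f (w (v, 0) + w (v, 2)) + f (w (v, 1)))) / Real.log 2 := by
    rw [ent, ← Finset.sum_div, Fintype.sum_prod_type]
    simp [law, pair, out₁, Fintype.sum_prod_type, Fin.sum_univ_three, Fin.sum_univ_two, hf,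
      Finset.sum_add_distrib, ite_and]
  have e2 : ent w (pair Prod.fst (out₂ ∘ Prod.snd)) =
      (∑ v, (f (w (v, 0)) + f (w (v, 1) + w (v, 2)))) / Real.log 2 := by
    rw [ent, ← Finset.sum_div, Fintype.sum_prod_type]
    simp [law, pair, out₂, Fintype.sum_prod_type, Fin.sum_univ_three, Fin.sum_univ_two, hf,
      Finset.sum_add_distrib, ite_and]
  have ey1 : ent w (out₁ ∘ Prod.snd) =
      (f (∑ v, (w (v, 0) + w (v, 2))) + f (∑ v, w (v, 1))) / Real.log 2 := by
    rw [ent, ← Finset.sum_div]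
    simp [law, out₁, Fintype.sum_prod_type, Fin.sum_univ_three, Fin.sum_univ_two, hf]
  have ey2 : ent w (out₂ ∘ Prod.snd) =
      (f (∑ v, w (v, 0)) + f (∑ v, (w (v, 1) + w (v, 2)))) / Real.log 2 := by
    rw [ent, ← Finset.sum_div]
    simp [law, out₂, Fintype.sum_prod_type, Fin.sum_univ_three, Fin.sum_univ_two, hf]
  have hs : ∑ v, (w (v, 0) + w (v, 1) + w (v, 2)) = 1 := by
    rw [← hsum, Fintype.sum_prod_type]
    simp [Fin.sum_univ_three]
  -- Relative entropy to $(\frac13,\frac23)$, the output law under uniform input. The resulting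
  -- bound on $H(Y_i)$ is linear in the masses, so it decomposes over the values of $V$ and the
  -- cellwise bounds can be summed.
  have gibbs : ∀ x y : ℝ, 0 ≤ x → 0 ≤ y → x + y = 1 →
      f x + f y ≤ Real.log 3 - Real.log 2 * y := by
    intro x y hx hy hxy
    have h1 := negMulLog_add_mul_log_le hx (y := 1 / 3) (by norm_num) (by norm_num)
    have h2 := negMulLog_add_mul_log_le hy (y := 2 / 3) (by norm_num) (by norm_num)
    rw [Real.log_div one_ne_zero three_ne_zero, Real.log_one] at h1
    rw [Real.log_div two_ne_zero three_ne_zero] at h2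
    have h3 : Real.log 3 * (x + y) = Real.log 3 := by rw [hxy, mul_one]
    simp only [hf]
    linarith
  have key := Finset.sum_le_sum fun v (_ : v ∈ Finset.univ) =>
    blackwell_cell (hw (v, 0)) (hw (v, 1)) (hw (v, 2))
  have g1 := gibbs (∑ v, w (v, 1)) (∑ v, (w (v, 0) + w (v, 2)))
    (Finset.sum_nonneg fun v _ => hw _)
    (Finset.sum_nonneg fun v _ => add_nonneg (hw _) (hw _))
    (by rw [← hs, ← Finset.sum_add_distrib]; exact Finset.sum_congr rfl fun _ _ => by ring)
  have g2 := gibbs (∑ v, w (v, 0)) (∑ v, (w (v, 1) + w (v, 2)))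
    (Finset.sum_nonneg fun v _ => hw _)
    (Finset.sum_nonneg fun v _ => add_nonneg (hw _) (hw _))
    (by rw [← hs, ← Finset.sum_add_distrib]; exact Finset.sum_congr rfl fun _ _ => by ring)
  rw [← hf] at key
  simp only [Finset.sum_sub_distrib, ← Finset.mul_sum, hs, mul_one] at key
  simp only [Finset.sum_add_distrib, Finset.sum_sub_distrib, ← Finset.mul_sum] at key g1 g2
  simp only [mutInfo, condEnt]
  rw [e0, eid, e1, e2, ey1, ey2, Real.logb]
  simp only [← add_div, ← sub_div, ← mul_div_assoc]
  refine div_le_div_of_nonneg_right ?_ hlog.le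
  simp only [Finset.sum_add_distrib]
  linarith

end Blackwell

/-! ### The new condition implies the Gohari-Anantharam condition -/

section Conditions

variable {S₁ S₂ : Type}

/-- Both left vertices are adjacent to the same right vertex, so the common part is almost surely a
function of $S_2$ as well. -/
theorem commonPart_eq_of_snd_eq {p : S₁ × S₂ → ℝ} {s s' : S₁ × S₂} (hs : p s ≠ 0) (hs' : p s' ≠ 0)
    (h : s.2 = s'.2) : commonPart p s = commonPart p s' := by
  have aux : ∀ t : S₁ × S₂, p t ≠ 0 →
      commonPart p t = (supportGraph p).connectedComponentMk (Sum.inr t.2) := by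
    intro t ht
    refine SimpleGraph.ConnectedComponent.sound (SimpleGraph.Adj.reachable ?_)
    rw [supportGraph, SimpleGraph.fromRel_adj]
    exact ⟨Sum.inl_ne_inr, Or.inl ⟨t.1, t.2, rfl, rfl, ht⟩⟩
  rw [aux s hs, aux s' hs', h]

/-- The new condition implies that of Gohari and Anantharam: let `U` be the common part. -/
theorem gohariAnantharam_of_newBound [Fintype S₁] [Fintype S₂] {p : S₁ × S₂ → ℝ}
    (h : NewBound p blackwell 1) :
    GohariAnantharam p blackwell 1 := by
  classical
  obtain ⟨pX, hpX, hnew⟩ := h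
  obtain ⟨V₀, V₁, V₂, _, _, _, q, hq, h⟩ := hnew (CommonAlphabet p) inferInstance
    (fun s u => if commonPart p s = u then 1 else 0) (isChannel_ite _)
  refine ⟨V₀, V₁, V₂, inferInstance, inferInstance, inferInstance, pX, q, hpX, hq, ?_⟩
  have hE : ∀ {B : Type} [Fintype B] (F : CommonAlphabet p × S₁ × S₂ → B),
      ent (sourceLaw (fun s u => if commonPart p s = u then 1 else 0) p) F =
        ent p fun s => F (commonPart p s, s.1, s.2) := fun F => by
    rw [sourceLaw_ite, ent_law]
    rfl
  have e₁ : ent p (fun s => (commonPart p s, s.1)) = ent p Prod.fst :=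
    ent_congr fun s s' _ _ => by
      simp only [Prod.mk.injEq, and_iff_right_iff_imp]
      intro h
      rw [commonPart, commonPart, h]
  have e₁' : ent p (fun s => (s.1, commonPart p s)) = ent p Prod.fst :=
    e₁ ▸ ent_congr fun s s' _ _ => by simp only [Prod.mk.injEq, and_comm]
  have e₂ : ent p (fun s => (commonPart p s, s.2)) = ent p Prod.snd :=
    ent_congr fun s s' hs hs' => by
      simp only [Prod.mk.injEq, and_iff_right_iff_imp]
      exact commonPart_eq_of_snd_eq hs hs'
  have e₂' : ent p (fun s => (s.2, commonPart p s)) = ent p Prod.snd :=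
    e₂ ▸ ent_congr fun s s' _ _ => by simp only [Prod.mk.injEq, and_comm]
  have e₃ : ent p (fun s => ((s.1, s.2), commonPart p s)) = ent p id :=
    ent_congr fun s s' hs hs' => by
      simp only [Prod.mk.injEq, id]
      refine ⟨fun h => Prod.ext h.1.1 h.1.2, ?_⟩
      rintro rfl
      exact ⟨⟨rfl, rfl⟩, rfl⟩
  dsimp only at h ⊢
  simp only [mutInfo_pair, one_mul] at h ⊢
  generalize testLaw q pX blackwell = P at h ⊢
  obtain ⟨h1, h2, h3, h4, h5, h6, h7, h8, h9, h10⟩ := h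
  rw [mutInfo, condEnt, hE, hE, hE] at h1 h2
  rw [hE] at h3 h4
  rw [mutInfo, condEnt, condEnt, hE, hE, hE, hE] at h5 h6 h7 h8 h9 h10
  simp only [pair] at h1 h2 h5 h6 h7 h8 h9 h10
  rw [e₁] at h1 h5 h7 h9
  rw [e₂] at h2 h6 h8 h10
  rw [e₂'] at h5
  rw [e₁'] at h6
  rw [e₃] at h7 h8 h9 h10
  have c : ent p (commonPart p) = ent p fun s => commonPart p s := rfl
  have c₁ : ent p Prod.fst = ent p fun s => s.1 := rfl
  have c₂ : ent p Prod.snd = ent p fun s => s.2 := rfl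
  -- For this $U$, $I(U;S_1)=I(U;S_2)=H(S_0)$. Splitting each minimum turns the five inequalities
  -- into ten, and these are the ten of the new condition.
  simp only [← min_add_add_right, le_min_iff]
  rw [c₁, c₂, c]
  rw [c₁] at h1 h5 h6 h7 h9
  rw [c₂] at h2 h5 h6 h8 h10
  refine ⟨⟨?_, ?_⟩, ⟨?_, ?_⟩, ⟨?_, ?_⟩, ⟨?_, ?_⟩, ?_, ?_⟩ <;> linarith

end Conditions

/-! ### The example: parameters, source entropies, and the two conditions -/

section Example

theorem binEnt_eq (t : ℝ) :
    binEnt t = (Real.negMulLog t + Real.negMulLog (1 - t)) / Real.log 2 := by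
  rw [binEnt, Real.binEntropy_eq_negMulLog_add_negMulLog_one_sub]

theorem binEnt_strictMonoOn : StrictMonoOn binEnt (Set.Icc 0 (1 / 2)) := by
  intro x hx y hy hxy
  rw [one_div] at hx hy
  exact div_lt_div_of_pos_right (Real.binEntropy_strictMonoOn hx hy hxy)
    (Real.log_pos one_lt_two)

theorem continuous_binEnt : Continuous binEnt := Real.binEntropy_continuous.div_const _

theorem binEntInv_spec {h : ℝ} (hh : h ∈ Set.Icc 0 1) :
    binEntInv h ∈ Set.Icc 0 (1 / 2) ∧ binEnt (binEntInv h) = h := by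
  have h0 : binEnt 0 = 0 := by simp [binEnt]
  have h1 : binEnt (1 / 2) = 1 := by
    have := (Real.log_pos one_lt_two).ne'
    rw [one_div, binEnt, Real.binEntropy_two_inv, div_self this]
  have : ∃ a ∈ Set.Icc (0 : ℝ) (1 / 2), binEnt a = h := by
    have := intermediate_value_Icc (f := binEnt) (a := 0) (b := 1 / 2) (by norm_num)
      continuous_binEnt.continuousOn
    rw [h0, h1] at this
    exact this hh
  exact ⟨Function.invFunOn_mem this, Function.invFunOn_eq this⟩

theorem logb_two_three_gt : 4 / 3 < Real.logb 2 3 := by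
  rw [Real.lt_logb_iff_rpow_lt one_lt_two three_pos]
  -- Cubing reduces the claim to $2^4=16<27=3^3$.
  refine lt_of_pow_lt_pow_left₀ 3 (by norm_num) ?_
  rw [← Real.rpow_mul_natCast two_pos.le]
  norm_num

theorem logb_two_three_lt : Real.logb 2 3 < 2 := by
  rw [Real.logb_lt_iff_lt_rpow one_lt_two three_pos]
  norm_num

theorem binary_sum (t : ℝ) : ∑ i, binary t i = 1 := by simp [binary]

theorem ent_binary (t : ℝ) : ent (binary t) id = binEnt t := by
  rw [binEnt_eq, ent, law_id, ← Finset.sum_div]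
  simp [binary]

theorem coupled_sum (α β : ℝ) : ∑ s, coupled α β s = 1 := by
  simp [coupled, Fintype.sum_prod_type]
  ring

theorem ent_coupled_fst (α β : ℝ) : ent (coupled α β) Prod.fst = binEnt α := by
  rw [binEnt_eq, ent, ← Finset.sum_div]
  simp [coupled, law, Fintype.sum_prod_type]
  ring_nf

theorem ent_coupled_snd (α β : ℝ) : ent (coupled α β) Prod.snd = binEnt α := by
  rw [binEnt_eq, ent, ← Finset.sum_div]
  simp [coupled, law, Fintype.sum_prod_type]
  ring_nf

theorem ent_coupled (α β : ℝ) : ent (coupled α β) id =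
    (Real.negMulLog (α * (1 - β)) + 2 * Real.negMulLog (α * β) +
      Real.negMulLog (1 - α - α * β)) / Real.log 2 := by
  rw [ent, law_id, ← Finset.sum_div]
  simp [coupled, Fintype.sum_prod_type]
  ring

/-- The derivative is $\alpha\log_2$ of the ratio of the diagonal product
$\alpha(1-\beta)(1-\alpha-\alpha\beta)$ to $(\alpha\beta)^2$. Their difference is
$\alpha(1-\alpha-\beta)$, positive until independence at $\beta=1-\alpha$. -/
theorem ent_coupled_strictMonoOn {α : ℝ} (h0 : 0 < α) (h1 : α < 1) :
    StrictMonoOn (fun β => ent (coupled α β) id) (Set.Icc 0 (1 - α)) := by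
  simp only [ent_coupled]
  refine strictMonoOn_of_deriv_pos (convex_Icc _ _) (Continuous.continuousOn (by fun_prop))
    fun β hβ => ?_
  rw [interior_Icc] at hβ
  obtain ⟨hβ0, hβ1⟩ := hβ
  have p1 : 0 < α * (1 - β) := mul_pos h0 (by linarith)
  have p2 : 0 < α * β := mul_pos h0 hβ0
  have p3 : 0 < 1 - α - α * β := by nlinarith
  have d1 : HasDerivAt (fun β => Real.negMulLog (α * (1 - β)))
      ((-Real.log (α * (1 - β)) - 1) * (α * (-1))) β :=
    HasDerivAt.comp (h₂ := Real.negMulLog) β (Real.hasDerivAt_negMulLog p1.ne')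
      (((hasDerivAt_id' β).const_sub 1).const_mul α)
  have d2 : HasDerivAt (fun β => Real.negMulLog (α * β)) ((-Real.log (α * β) - 1) * (α * 1)) β :=
    (Real.hasDerivAt_negMulLog p2.ne').comp β ((hasDerivAt_id' β).const_mul α)
  have d3 : HasDerivAt (fun β => Real.negMulLog (1 - α - α * β))
      ((-Real.log (1 - α - α * β) - 1) * (-(α * 1))) β :=
    HasDerivAt.comp (h₂ := Real.negMulLog) β (Real.hasDerivAt_negMulLog p3.ne')
      (((hasDerivAt_id' β).const_mul α).const_sub (1 - α))
  refine lt_of_lt_of_eq ?_ (((d1.add (d2.const_mul 2)).add d3).div_const (Real.log 2)).deriv.symm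
  refine div_pos ?_ (Real.log_pos one_lt_two)
  have hlt : (α * β) * (α * β) < (α * (1 - β)) * (1 - α - α * β) := by
    nlinarith [mul_pos h0 (sub_pos.2 hβ1)]
  have := Real.log_lt_log (mul_pos p2 p2) hlt
  rw [Real.log_mul p2.ne' p2.ne', Real.log_mul p1.ne' p3.ne'] at this
  nlinarith

theorem ent_coupled_zero (α : ℝ) : ent (coupled α 0) id = binEnt α := by
  rw [ent_coupled, binEnt_eq]
  simp

theorem ent_coupled_one_sub (α : ℝ) : ent (coupled α (1 - α)) id = 2 * binEnt α := by
  have e : 1 - α - α * (1 - α) = (1 - α) * (1 - α) := by ring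
  rw [ent_coupled, binEnt_eq, e, sub_sub_cancel]
  simp only [Real.negMulLog_mul]
  ring

theorem alphaMax_spec : alphaMax ∈ Set.Icc 0 (1 / 2) ∧
    binEnt alphaMax = Real.logb 2 3 - 4 / 3 :=
  binEntInv_spec ⟨by linarith [logb_two_three_gt], by linarith [logb_two_three_lt]⟩

theorem alphaMin_spec : binEntInv (Real.logb 2 3 / 2 - 2 / 3) ∈ Set.Icc 0 (1 / 2) ∧
    binEnt (binEntInv (Real.logb 2 3 / 2 - 2 / 3)) = Real.logb 2 3 / 2 - 2 / 3 :=
  binEntInv_spec ⟨by linarith [logb_two_three_gt], by linarith [logb_two_three_lt]⟩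

theorem alphaRange_nonempty : alphaRange.Nonempty := by
  refine Set.nonempty_Ico.2 ((binEnt_strictMonoOn.lt_iff_lt alphaMin_spec.1 alphaMax_spec.1).1 ?_)
  rw [alphaMin_spec.2, alphaMax_spec.2]
  linarith [logb_two_three_gt]

theorem alphaRange_bounds {α : ℝ} (h : α ∈ alphaRange) : 0 < α ∧ α < 1 / 2 ∧
    Real.logb 2 3 / 2 - 2 / 3 ≤ binEnt α ∧ binEnt α < Real.logb 2 3 - 4 / 3 := by
  have hmin := alphaMin_spec
  have hmax := alphaMax_spec
  have h1 : α < 1 / 2 := h.2.trans_le hmax.1.2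
  have hα : α ∈ Set.Icc (0 : ℝ) (1 / 2) := ⟨hmin.1.1.trans h.1, h1.le⟩
  have h2 : Real.logb 2 3 / 2 - 2 / 3 ≤ binEnt α :=
    hmin.2 ▸ (binEnt_strictMonoOn.le_iff_le hmin.1 hα).2 h.1
  refine ⟨hα.1.lt_of_ne' ?_, h1, h2, hmax.2 ▸ binEnt_strictMonoOn hα hmax.1 h.2⟩
  rintro rfl
  have : binEnt 0 = 0 := by simp [binEnt]
  linarith [logb_two_three_gt]

/-- The joint entropy increases from $H_b(\alpha)$ at $\beta=0$ to $2H_b(\alpha)$ at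
$\beta=1-\alpha$; the ends of the parameter interval are exactly what places the target between
these values. -/
theorem existsUnique_isBeta {α : ℝ} (h : α ∈ alphaRange) : ∃! β, IsBeta α β := by
  obtain ⟨h0, h1, h2, h3⟩ := alphaRange_bounds h
  have hmono := ent_coupled_strictMonoOn h0 (by linarith)
  have hle : (0 : ℝ) ≤ 1 - α := by linarith
  have hcont : Continuous fun β => ent (coupled α β) id := by
    simp only [ent_coupled]
    fun_prop
  have hivt := intermediate_value_Icc hle hcont.continuousOn
  simp only [ent_coupled_zero, ent_coupled_one_sub] at hivt
  obtain ⟨β, hβ, he⟩ := hivt (a := Real.logb 2 3 - 4 / 3) ⟨h3.le, by linarith⟩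
  refine ⟨β, ⟨⟨hβ.1.lt_of_ne' ?_, hβ.2⟩, he⟩, fun β' hβ' => ?_⟩
  · rintro rfl
    simp only [ent_coupled_zero] at he
    linarith
  · exact hmono.injOn ⟨hβ'.1.1.le, hβ'.1.2⟩ hβ (hβ'.2.trans he.symm)

/-- Additivity of entropy over the three independent blocks. Identities, projections and constants
for `F`, `G`, `K` yield every source entropy needed below. -/
theorem ent_exampleSource {A B C : Type*} [Fintype A] [Fintype B] [Fintype C] (α β : ℝ)
    (F : Fin 2 × Fin 2 → A) (G : Fin 2 → B) (K : Fin 2 → C) :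
    ent (exampleSource α β) (fun s => ((F (s.1.1, s.2.1), G s.1.2), K s.2.2)) =
      ent (coupled α β) F + ent (binary (binEntInv (2 / 3))) G +
        ent (binary (binEntInv (2 / 3))) K := by
  classical
  set b := binary (binEntInv (2 / 3)) with hb
  have hsum : ∑ z : (Fin 2 × Fin 2) × Fin 2, coupled α β z.1 * b z.2 = 1 := by
    rw [Fintype.sum_prod_type]
    simp only [← Finset.mul_sum, hb, binary_sum, mul_one, coupled_sum]
  rw [← ent_mul (coupled_sum α β) (binary_sum _), ← ent_mul hsum (binary_sum _)]
  have hlaw : exampleSource α β = law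
      (fun z : ((Fin 2 × Fin 2) × Fin 2) × Fin 2 => coupled α β z.1.1 * b z.1.2 * b z.2)
      (fun z => ((z.1.1.1, z.1.2), (z.1.1.2, z.2))) := by
    funext ⟨⟨s₁, s₂⟩, s₃, s₄⟩
    rw [law, Finset.sum_eq_single (((s₁, s₃), s₂), s₄)]
    · simp [exampleSource, hb]
    · rintro ⟨⟨⟨a, a'⟩, c⟩, d⟩ - h
      rw [if_neg]
      simp only [ne_eq, Prod.mk.injEq, not_and] at h ⊢
      tauto
    · simp
  rw [hlaw, ent_law]
  rfl

theorem binEntInv_two_thirds : 0 < binEntInv (2 / 3) ∧ binEntInv (2 / 3) ≤ 1 / 2 ∧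
    binEnt (binEntInv (2 / 3)) = 2 / 3 := by
  have h := binEntInv_spec (h := 2 / 3) (by norm_num)
  refine ⟨h.1.1.lt_of_ne' fun h0 => ?_, h.1.2, h.2⟩
  rw [h0] at h
  have : binEnt 0 = 0 := by simp [binEnt]
  linarith [h.2]

theorem exampleSource_pos {α β : ℝ} (hα : α ∈ alphaRange) (hβ : IsBeta α β)
    (s : (Fin 2 × Fin 2) × (Fin 2 × Fin 2)) : 0 < exampleSource α β s := by
  obtain ⟨h0, h1, -⟩ := alphaRange_bounds hα
  obtain ⟨t0, t1, -⟩ := binEntInv_two_thirds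
  obtain ⟨b0, b1⟩ := hβ.1
  have p1 : 0 < α * (1 - β) := mul_pos h0 (by linarith)
  have p2 : 0 < α * β := mul_pos h0 b0
  have p3 : 0 < 1 - α - α * β := by nlinarith
  have hb : ∀ i, 0 < binary (binEntInv (2 / 3)) i := by
    intro i
    fin_cases i
    · simpa [binary] using t0
    · simp only [binary, Fin.mk_one, Matrix.cons_val_one, Matrix.cons_val_fin_one]
      linarith
  have hc : ∀ z, 0 < coupled α β z := by
    rintro ⟨i, j⟩
    fin_cases i <;> fin_cases j <;> simp only [coupled] <;> assumption
  exact mul_pos (mul_pos (hc _) (hb _)) (hb _)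

theorem exampleSource_mem_stdSimplex {α β : ℝ} (hα : α ∈ alphaRange) (hβ : IsBeta α β) :
    exampleSource α β ∈ stdSimplex ℝ ((Fin 2 × Fin 2) × (Fin 2 × Fin 2)) := by
  refine ⟨fun s => (exampleSource_pos hα hβ s).le, ?_⟩
  simp [exampleSource, coupled, binary, Fintype.sum_prod_type]
  ring

theorem ent_commonPart_exampleSource {α β : ℝ} (hα : α ∈ alphaRange) (hβ : IsBeta α β) :
    ent (exampleSource α β) (commonPart (exampleSource α β)) = 0 := by
  refine ent_of_const (exampleSource_mem_stdSimplex hα hβ).2 fun s s' _ hs' => ?_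
  -- The common part depends only on the first source, so `s` may be replaced by `(s.1, s'.2)`,
  -- which has positive mass and shares its second source with `s'`.
  exact commonPart_eq_of_snd_eq (s := (s.1, s'.2)) (exampleSource_pos hα hβ _).ne' hs' rfl

theorem ent_const_binary (t : ℝ) : ent (binary t) (fun _ => ()) = 0 :=
  ent_of_const (binary_sum t) fun _ _ _ _ => rfl

theorem ent_exampleSource_fst_fst (α β : ℝ) :
    ent (exampleSource α β) (fun s => s.1.1) = binEnt α := by
  have h := ent_exampleSource α β Prod.fst (fun _ => ()) (fun _ => ())
  rw [ent_coupled_fst, ent_const_binary, add_zero, add_zero] at h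
  rw [← h]
  exact ent_congr fun _ _ _ _ => by simp

theorem ent_exampleSource_fst (α β : ℝ) :
    ent (exampleSource α β) (fun s => s.1) = binEnt α + 2 / 3 := by
  have h := ent_exampleSource α β Prod.fst id (fun _ => ())
  rw [ent_coupled_fst, ent_const_binary, ent_binary, binEntInv_two_thirds.2.2, add_zero] at h
  rw [← h]
  exact ent_congr fun _ _ _ _ => by simp [Prod.ext_iff]

theorem ent_exampleSource_snd (α β : ℝ) :
    ent (exampleSource α β) (fun s => s.2) = binEnt α + 2 / 3 := by
  have h := ent_exampleSource α β Prod.snd (fun _ => ()) id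
  rw [ent_coupled_snd, ent_const_binary, ent_binary, binEntInv_two_thirds.2.2, add_zero] at h
  rw [← h]
  exact ent_congr fun _ _ _ _ => by simp [Prod.ext_iff]

theorem ent_exampleSource_id {α β : ℝ} (hβ : IsBeta α β) :
    ent (exampleSource α β) id = Real.logb 2 3 := by
  have h := ent_exampleSource α β id id id
  rw [hβ.2, ent_binary, binEntInv_two_thirds.2.2] at h
  rw [show Real.logb 2 3 = Real.logb 2 3 - 4 / 3 + 2 / 3 + 2 / 3 by ring, ← h]
  exact ent_congr fun _ _ _ _ => by simp [Prod.ext_iff]; tauto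

theorem ent_exampleSource_fst_fst_snd {α β : ℝ} (hβ : IsBeta α β) :
    ent (exampleSource α β) (fun s => (s.1.1, s.2)) = Real.logb 2 3 - 2 / 3 := by
  have h := ent_exampleSource α β id (fun _ => ()) id
  rw [hβ.2, ent_binary, ent_const_binary, binEntInv_two_thirds.2.2] at h
  rw [show Real.logb 2 3 - 2 / 3 = Real.logb 2 3 - 4 / 3 + 0 + 2 / 3 by ring, ← h]
  exact ent_congr fun _ _ _ _ => by simp [Prod.ext_iff]; tauto

theorem gohariAnantharam_exampleSource {α β : ℝ} (hα : α ∈ alphaRange) (hβ : IsBeta α β) :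
    GohariAnantharam (exampleSource α β) blackwell 1 := by
  obtain ⟨-, -, -, hlt⟩ := alphaRange_bounds hα
  set pX : Fin 3 → ℝ := fun _ => 1 / 3 with hpX
  have hsum : ∑ x, pX x = 1 := by simp [hpX]
  -- Constant $V_0$, $V_i=Y_i$ and uniform input; both sum-rate inequalities then hold with
  -- equality.
  refine ⟨Unit, Fin 2, Fin 2, inferInstance, inferInstance, inferInstance, pX,
    fun x v => if ((), out₁ x, out₂ x) = v then 1 else 0, ⟨fun _ => by simp [hpX], hsum⟩,
    isChannel_ite _, ?_⟩
  have hE : ∀ {B : Type} [Fintype B] (F : Unit × Fin 2 × Fin 2 × Fin 3 × Fin 2 × Fin 2 → B),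
      ent (testLaw (fun x v => if ((), out₁ x, out₂ x) = v then 1 else 0) pX blackwell) F =
        ent pX fun x => F ((), out₁ x, out₂ x, x, out₁ x, out₂ x) := fun F => by
    rw [testLaw_ite, ent_law]
    rfl
  have hlog := (Real.log_pos one_lt_two).ne'
  have log3 : Real.log (1 / 3) = -Real.log 3 := by rw [one_div, Real.log_inv]
  have c0 : ∀ {B : Type} [Fintype B] (F : Fin 3 → B), (∀ x x', F x = F x') → ent pX F = 0 :=
    fun F h => ent_of_const hsum fun x x' _ _ => h x x'
  have log23 : Real.log (1 / 3 + 1 / 3) = Real.log 2 - Real.log 3 := by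
    rw [← Real.log_div two_ne_zero three_ne_zero]
    norm_num
  have y1 : ent pX out₁ = Real.logb 2 3 - 2 / 3 := by
    rw [ent, ← Finset.sum_div, Real.logb]
    simp [law, out₁, Fin.sum_univ_three, Fin.sum_univ_two, hpX, Real.negMulLog, -one_div, log3,
      log23]
    field_simp
    ring
  have y2 : ent pX out₂ = Real.logb 2 3 - 2 / 3 := by
    rw [ent, ← Finset.sum_div, Real.logb]
    simp [law, out₂, Fin.sum_univ_three, Fin.sum_univ_two, hpX, Real.negMulLog, -one_div, log3,
      log23]
    field_simp
    ring
  have yid : ent pX id = Real.logb 2 3 := by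
    rw [ent, ← Finset.sum_div, Real.logb, law_id]
    simp [hpX, Real.negMulLog, -one_div, log3]
    field_simp
  have c1 : ∀ {B : Type} [Fintype B] (F : Fin 3 → B),
      (∀ x x', F x = F x' ↔ out₁ x = out₁ x') → ent pX F = Real.logb 2 3 - 2 / 3 :=
    fun F h => y1 ▸ ent_congr fun x x' _ _ => h x x'
  have c2 : ∀ {B : Type} [Fintype B] (F : Fin 3 → B),
      (∀ x x', F x = F x' ↔ out₂ x = out₂ x') → ent pX F = Real.logb 2 3 - 2 / 3 :=
    fun F h => y2 ▸ ent_congr fun x x' _ _ => h x x'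
  have c3 : ∀ {B : Type} [Fintype B] (F : Fin 3 → B),
      (∀ x x', F x = F x' ↔ x = x') → ent pX F = Real.logb 2 3 :=
    fun F h => yid ▸ ent_congr fun x x' _ _ => h x x'
  dsimp only
  simp only [mutInfo, condMutInfo, condEnt, hE, pair, one_mul]
  have f1 : ent (exampleSource α β) Prod.fst = _ := ent_exampleSource_fst α β
  have f2 : ent (exampleSource α β) Prod.snd = _ := ent_exampleSource_snd α β
  rw [ent_commonPart_exampleSource hα hβ, f1, f2, ent_exampleSource_id hβ]
  rw [c0 (fun _ => ()) (by simp), c1 (fun x => ((), out₁ x)) (by simp),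
    c2 (fun x => ((), out₂ x)) (by simp), c1 (fun x => out₁ x) (by simp),
    c2 (fun x => out₂ x) (by simp), c1 (fun x => (out₁ x, ())) (by simp),
    c2 (fun x => (out₂ x, ())) (by simp), c1 (fun x => (out₁ x, out₁ x, ())) (by simp),
    c2 (fun x => (out₂ x, out₂ x, ())) (by simp), c3 (fun x => (x, (), out₁ x)) (by decide),
    c3 (fun x => (x, (), out₂ x)) (by decide), c3 (fun x => (x, out₂ x, (), out₁ x)) (by decide),
    c3 (fun x => (x, out₁ x, (), out₂ x)) (by decide),
    c3 (fun x => (out₂ x, (), out₁ x)) (by decide), c3 (fun x => (out₁ x, (), out₂ x)) (by decide)]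
  simp only [sub_self, min_self]
  refine ⟨le_rfl, ?_, ?_, ?_, ?_⟩ <;> linarith

theorem binEnt_le_of_newBound {α β : ℝ} (hβ : IsBeta α β)
    (h : NewBound (exampleSource α β) blackwell 1) :
    binEnt α ≤ 10 * (Real.logb 2 3 - 4 / 3 - binEnt α) := by
  obtain ⟨pX, hpX, h⟩ := h
  -- The choice $U=\tilde S_0$: a function of $S_1$, but only correlated with $S_2$.
  obtain ⟨V₀, V₁, V₂, _, _, _, q, hq, h⟩ := h (Fin 2) inferInstance
    (fun s u => if s.1.1 = u then 1 else 0) (isChannel_ite _)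
  have hE : ∀ {B : Type} [Fintype B] (F : Fin 2 × (Fin 2 × Fin 2) × (Fin 2 × Fin 2) → B),
      ent (sourceLaw (fun s u => if s.1.1 = u then 1 else 0) (exampleSource α β)) F =
        ent (exampleSource α β) fun s => F (s.1.1, s.1, s.2) := fun F => by
    rw [sourceLaw_ite, ent_law]
    rfl
  have e₁ : ent (exampleSource α β) (fun s => (s.1.1, s.1)) = binEnt α + 2 / 3 := by
    rw [← ent_exampleSource_fst α β]
    exact ent_congr fun _ _ _ _ => by simp [Prod.ext_iff]
  have e₂ : ent (exampleSource α β) (fun s => ((s.1, s.2), s.1.1)) = Real.logb 2 3 := by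
    rw [← ent_exampleSource_id hβ]
    exact ent_congr fun _ _ _ _ => by simp [Prod.ext_iff]; tauto
  dsimp only at h
  obtain ⟨h1, -, -, -, -, -, h7, h8, -⟩ := h
  have hP := testLaw_nonneg hq hpX isChannel_blackwell
  have hP1 := sum_testLaw hq hpX isChannel_blackwell
  have hsupp := fun ω => testLaw_blackwell_support (q := q) (pX := pX) (ω := ω)
  generalize testLaw q pX blackwell = P at h1 h7 h8 hP hP1 hsupp
  set v₀ : V₀ × V₁ × V₂ × Fin 3 × Fin 2 × Fin 2 → V₀ := fun ω => ω.1 with hv₀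
  set x : V₀ × V₁ × V₂ × Fin 3 × Fin 2 × Fin 2 → Fin 3 := fun ω => ω.2.2.2.1 with hx
  set y₁ : V₀ × V₁ × V₂ × Fin 3 × Fin 2 × Fin 2 → Fin 2 := fun ω => ω.2.2.2.2.1 with hy₁
  set y₂ : V₀ × V₁ × V₂ × Fin 3 × Fin 2 × Fin 2 → Fin 2 := fun ω => ω.2.2.2.2.2 with hy₂
  have hxy : ∀ ω ω', P ω ≠ 0 → P ω' ≠ 0 → (x ω = x ω' ↔ y₁ ω = y₁ ω' ∧ y₂ ω = y₂ ω') := by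
    intro ω ω' hω hω'
    simp only [hx, hy₁, hy₂, (hsupp ω hω).1, (hsupp ω hω).2, (hsupp ω' hω').1, (hsupp ω' hω').2]
    exact ⟨fun h => by simp [h], fun h => out_injective h.1 h.2⟩
  have b1 := mutInfo_add_condMutInfo_le hP v₀ (fun ω => ω.2.1) x y₁ y₂ hxy
  have b2 := mutInfo_add_condMutInfo_le hP v₀ (fun ω => ω.2.2.1) x y₂ y₁
    fun ω ω' hω hω' => by rw [hxy ω ω' hω hω', and_comm]
  have key := blackwell_mutInfo_le (w := law P (pair v₀ x)) (law_nonneg hP _)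
    (by rw [sum_law, hP1])
  have o1 : ent P ((out₁ ∘ Prod.snd) ∘ pair v₀ x) = ent P y₁ :=
    ent_congr fun ω ω' hω hω' => by
      simp only [hy₁, (hsupp ω hω).1, (hsupp ω' hω').1]
      rfl
  have o2 : ent P ((out₂ ∘ Prod.snd) ∘ pair v₀ x) = ent P y₂ :=
    ent_congr fun ω ω' hω hω' => by
      simp only [hy₂, (hsupp ω hω).2, (hsupp ω' hω').2]
      rfl
  have o3 : ent P (pair Prod.fst (out₁ ∘ Prod.snd) ∘ pair v₀ x) = ent P (pair v₀ y₁) :=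
    ent_congr fun ω ω' hω hω' => by
      simp only [pair, hy₁, (hsupp ω hω).1, (hsupp ω' hω').1]
      rfl
  have o4 : ent P (pair Prod.fst (out₂ ∘ Prod.snd) ∘ pair v₀ x) = ent P (pair v₀ y₂) :=
    ent_congr fun ω ω' hω hω' => by
      simp only [pair, hy₂, (hsupp ω hω).2, (hsupp ω' hω').2]
      rfl
  have o5 : ent P (Prod.fst ∘ pair v₀ x) = ent P v₀ := rfl
  simp only [mutInfo, condEnt, ent_law, o1, o2, o3, o4, o5, Function.id_comp] at key
  rw [one_mul] at h1 h7 h8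
  -- The source side of `h7` is $\log_2 3$ and that of `h8` is $H_b(\alpha)+\frac43$.
  replace h7 := h7.trans b1
  replace h8 := h8.trans b2
  simp only [mutInfo, condEnt, hE] at h1 h7 h8
  simp only [pair] at h1 h7 h8 key
  rw [e₁, ent_exampleSource_fst_fst, ent_exampleSource_fst] at h1
  rw [e₁, e₂, ent_exampleSource_fst_fst, ent_exampleSource_fst] at h7
  rw [ent_exampleSource_fst_fst_snd hβ, e₂, ent_exampleSource_fst_fst, ent_exampleSource_snd] at h8
  linarith

theorem exists_forall_not_newBound : ∃ δ > 0, ∀ α ∈ alphaRange, alphaMax - δ < α →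
    ∀ β, IsBeta α β → ¬ NewBound (exampleSource α β) blackwell 1 := by
  have hmax := alphaMax_spec.2
  -- The bound of `binEnt_le_of_newBound` rearranges to $H_b(\alpha)\le\frac{10}{11}H_b(\alpha^*)$,
  -- which continuity excludes near $\alpha^*$.
  have hpos : 10 / 11 * binEnt alphaMax < binEnt alphaMax := by
    linarith [logb_two_three_gt]
  obtain ⟨δ, hδ, h⟩ := Metric.eventually_nhds_iff.1
    (continuous_binEnt.continuousAt.eventually_const_lt hpos)
  refine ⟨δ, hδ, fun α hα hlt β hβ hnew => ?_⟩
  have h1 : dist α alphaMax < δ := by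
    rw [Real.dist_eq, abs_lt]
    constructor <;> linarith [hα.2]
  have h2 := h h1
  have h3 := binEnt_le_of_newBound hβ hnew
  linarith

end Example

end CorrBC

end

open CorrBC
theorem mainTheorem7 :
    alphaRange.Nonempty ∧
    (∀ α ∈ alphaRange, ∃! β, IsBeta α β) ∧
    (∀ α ∈ alphaRange, ∀ β, IsBeta α β →
      exampleSource α β ∈ stdSimplex ℝ ((Fin 2 × Fin 2) × (Fin 2 × Fin 2)) ∧
      ent (exampleSource α β) (commonPart (exampleSource α β)) = 0 ∧
      GohariAnantharam (exampleSource α β) blackwell 1) ∧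
    (∃ δ > 0, ∀ α ∈ alphaRange, alphaMax - δ < α → ∀ β, IsBeta α β →
      ¬ NewBound (exampleSource α β) blackwell 1) ∧
    {p ∈ stdSimplex ℝ ((Fin 2 × Fin 2) × (Fin 2 × Fin 2)) | NewBound p blackwell 1} ⊂
      {p ∈ stdSimplex ℝ ((Fin 2 × Fin 2) × (Fin 2 × Fin 2)) | GohariAnantharam p blackwell 1} := by
  refine ⟨alphaRange_nonempty, fun α hα => existsUnique_isBeta hα, fun α hα β hβ =>
    ⟨exampleSource_mem_stdSimplex hα hβ, ent_commonPart_exampleSource hα hβ,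
      gohariAnantharam_exampleSource hα hβ⟩, exists_forall_not_newBound,
    fun p hp => ⟨hp.1, gohariAnantharam_of_newBound hp.2⟩, fun hsub => ?_⟩
  obtain ⟨δ, hδ, h⟩ := exists_forall_not_newBound
  have hlt := Set.nonempty_Ico.1 alphaRange_nonempty
  obtain ⟨α, hα, hα'⟩ := exists_between (max_lt hlt (sub_lt_self alphaMax hδ))
  have hmem : α ∈ alphaRange := ⟨(le_max_left _ _).trans hα.le, hα'⟩
  obtain ⟨β, hβ, -⟩ := existsUnique_isBeta hmem
  exact h α hmem ((le_max_right _ _).trans_lt hα) β hβ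
    (hsub ⟨exampleSource_mem_stdSimplex hmem hβ, gohariAnantharam_exampleSource hmem hβ⟩).2
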